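/- Let $\mathbb M_{n_1,n_2}$ be the space of real or complex $n_1\times n_2$ matrices with the inner product $\langle X,Y\rangle=\mathrm{Re}\,\mathrm{tr}(X^*Y)$ and its Frobenius norm $\|\cdot\|$. Let $E$ be a finite-dimensional real inner product space (e.g. $\mathbb R^m$, or $\mathbb C^m$ with the real part of its inner product), let $\mathcal A:\mathbb M_{n_1,n_2}\to E$ be a real-linear operator with adjoint $\mathcal A^*$ and operator norm $\|\mathcal A\|$, let $b\in E$ and let $K\ge 1$ be an integer. (Complex-linear operators into $\mathbb C^m$ are a special case, with the same norm and adjoint.) Let $\iota_{R_K}(X)=0$ if $\mathrm{rank}(X)\le K$ and $\iota_{R_K}(X)=+\infty$ otherwise. For a functional $f$ with extended real values put $\mathcal S_2(f)(Y)=\sup_X\big(-f(X)-\|X-Y\|^2\big)$ and let $\mathcal Q_2=\mathcal S_2\circ\mathcal S_2$ be the quadratic envelope. Define $$\mathcal R_{K,reg}(X)=\mathcal Q_2(\iota_{R_K})(X)+\|\mathcal AX-b\|^2 .$$ For an integer $k\ge1$ define the lower restricted isometry constant $\delta_k^-$ by $$1-\delta_k^-=\inf\Big\{\frac{\|\mathcal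 AX\|^2}{\|X\|^2}:\ X\ne0,\ \mathrm{rank}(X)\le k\Big\},$$ where the infimum of the empty set, which occurs only if $\mathbb M_{n_1,n_2}=\{0\}$, is taken to be $0$. Let $\sigma_1(Z)\ge\sigma_2(Z)\ge\dots$ be the singular values of $Z$, with $\sigma_j(Z)=0$ for $j>\min(n_1,n_2)$. Suppose that $\|\mathcal A\|<1$. 1. If $\delta_K^-<1$, then $\mathcal R_{K,reg}$ has a global minimizer. 2. Let $X'$ be a global minimizer of $\mathcal R_{K,reg}$ and put $Z'=(I-\mathcal A^*\mathcal A)X'+\mathcal A^*b$. If $$\sigma_{K+1}(Z')<(1-2\delta_{2K}^-)\,\sigma_K(Z'),$$ then $X'$ is the unique global minimizer of $\mathcal R_{K,reg}$, and $\mathcal R_{K,reg}$ has no local minimizer other than $X'$. -/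

import Mathlib

open scoped Matrix

/-! Matrices carry the Frobenius norm throughout; `𝕜` is `ℝ` or `ℂ`. -/

attribute [local instance] Matrix.frobeniusNormedAddCommGroup Matrix.frobeniusNormedSpace

namespace LowRank

theorem frobenius_norm_sq_eq_trace {𝕜 : Type*} [RCLike 𝕜] {m n : ℕ}
    (X : Matrix (Fin m) (Fin n) 𝕜) :
    ‖X‖ ^ 2 = RCLike.re (Matrix.trace (Xᴴ * X)) := by
  have h0 : 0 ≤ ∑ i, ∑ j, ‖X i j‖ ^ (2 : ℝ) := by positivity
  rw [Matrix.frobenius_norm_def, ← Real.sqrt_eq_rpow, Real.sq_sqrt h0, Finset.sum_comm]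
  simp only [Matrix.trace, Matrix.diag, Matrix.mul_apply, Matrix.conjTranspose_apply, map_sum]
  refine Finset.sum_congr rfl fun j _ => Finset.sum_congr rfl fun i _ => ?_
  rw [RCLike.star_def, RCLike.conj_mul, Real.rpow_two]
  norm_cast

/-- The real inner product `Re tr (Xᴴ Y)` on matrices over `𝕜`, inducing the Frobenius norm. -/
noncomputable instance frobeniusInner {𝕜 : Type*} [RCLike 𝕜] {m n : ℕ} :
    InnerProductSpace ℝ (Matrix (Fin m) (Fin n) 𝕜) :=
  { (inferInstance : NormedSpace ℝ (Matrix (Fin m) (Fin n) 𝕜)) with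
    inner := fun X Y => RCLike.re (Matrix.trace (Xᴴ * Y))
    norm_sq_eq_re_inner := fun X => frobenius_norm_sq_eq_trace X
    conj_inner_symm := fun X Y => by
      have h : Matrix.trace (Xᴴ * Y) = star (Matrix.trace (Yᴴ * X)) := by
        rw [← Matrix.trace_conjTranspose, Matrix.conjTranspose_mul,
          Matrix.conjTranspose_conjTranspose]
      simp [h]
    add_left := fun X Y Z => by
      simp [Matrix.conjTranspose_add, Matrix.add_mul, Matrix.trace_add]
    smul_left := fun X Y r => by
      simp [Matrix.conjTranspose_smul, Matrix.trace_smul, RCLike.smul_re] }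

/-- `𝒮_γ(f)(Y) = sup_X (-f(X) - (γ/2) ‖X - Y‖²)`. -/
noncomputable def quadTransform {V : Type*} [NormedAddCommGroup V] (γ : ℝ) (f : V → EReal) :
    V → EReal :=
  fun Y => ⨆ X : V, (-f X - ((γ / 2 * ‖X - Y‖ ^ 2 : ℝ) : EReal))

/-- The quadratic envelope `𝒬_γ = 𝒮_γ ∘ 𝒮_γ`. -/
noncomputable def quadEnvelope {V : Type*} [NormedAddCommGroup V] (γ : ℝ) (f : V → EReal) :
    V → EReal :=
  quadTransform γ (quadTransform γ f)

/-- The indicator functional `ι_{R_K}` of the matrices of rank at most `K`. -/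
noncomputable def rankIndicator {𝕜 : Type*} [RCLike 𝕜] {m n : ℕ} (K : ℕ)
    (X : Matrix (Fin m) (Fin n) 𝕜) : EReal :=
  if X.rank ≤ K then 0 else ⊤

/-- The operator norm of a linear map between finite-dimensional inner product spaces. -/
noncomputable def opNorm {V W : Type*} [NormedAddCommGroup V] [InnerProductSpace ℝ V]
    [FiniteDimensional ℝ V] [NormedAddCommGroup W] [InnerProductSpace ℝ W] (A : V →ₗ[ℝ] W) : ℝ :=
  ‖LinearMap.toContinuousLinearMap A‖

/-- The lower restricted isometry constant `δ_K⁻` of `A`: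
`1 - δ_K⁻ = inf {‖A X‖² / ‖X‖² : X ≠ 0, rank X ≤ K}`. -/
noncomputable def lrip {𝕜 : Type*} [RCLike 𝕜] {m n : ℕ} {E : Type*} [NormedAddCommGroup E]
    [InnerProductSpace ℝ E] (A : Matrix (Fin m) (Fin n) 𝕜 →ₗ[ℝ] E) (K : ℕ) : ℝ :=
  1 - sInf {r : ℝ | ∃ X : Matrix (Fin m) (Fin n) 𝕜,
    X ≠ 0 ∧ X.rank ≤ K ∧ r = ‖A X‖ ^ 2 / ‖X‖ ^ 2}

/-- The `j`-th largest singular value, `j = 1, 2, …` (Mathlib numbers them from `0`);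
it is `0` beyond the size of the matrix. -/
noncomputable def sigma {𝕜 : Type*} [RCLike 𝕜] {m n : ℕ} (j : ℕ)
    (Z : Matrix (Fin m) (Fin n) 𝕜) : ℝ :=
  (Matrix.toEuclideanLin Z).singularValues (j - 1)

/-- The regularized objective `𝒬₂(ι_{R_K})(X) + ‖A X - b‖²`. -/
noncomputable def regObjective {𝕜 : Type*} [RCLike 𝕜] {m n : ℕ} {E : Type*}
    [NormedAddCommGroup E] [InnerProductSpace ℝ E] (A : Matrix (Fin m) (Fin n) 𝕜 →ₗ[ℝ] E)
    (b : E) (K : ℕ) (X : Matrix (Fin m) (Fin n) 𝕜) : EReal :=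
  quadEnvelope 2 (rankIndicator K) X + ((‖A X - b‖ ^ 2 : ℝ) : EReal)

/-- The point `Z = (I - A⋆A) X + A⋆ b` associated with `X`. -/
noncomputable def assocPoint {𝕜 : Type*} [RCLike 𝕜] {m n : ℕ} {E : Type*}
    [NormedAddCommGroup E] [InnerProductSpace ℝ E] [FiniteDimensional ℝ E]
    (A : Matrix (Fin m) (Fin n) 𝕜 →ₗ[ℝ] E) (b : E) (X : Matrix (Fin m) (Fin n) 𝕜) :
    Matrix (Fin m) (Fin n) 𝕜 :=
  (X - LinearMap.adjoint A (A X)) + LinearMap.adjoint A b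

end LowRank

/-! Write C for the closed set of matrices of rank at most K. The quadratic envelope of its
indicator is a convex function, equal to at most ‖·‖² on C, minus ‖·‖². Since ‖A‖ < 1, the remaining
quadratic ‖AX - b‖² - ‖X‖² is strictly concave, and its gradient at X is -2Z with Z the associated
point. Moving from X towards a point W of C nearest to Z thus strictly lowers the objective unless W
= X. Hence every local minimizer lies in C and is a nearest point of C to its own Z
(`isNearest_of_isLocalMin`). The same comparison without strictness shows that least squares
minimizers over C, which exist by coercivity when δ_K < 1, minimize the objective globally
(`envObjective_le_of_isMinOn`). For uniqueness let X, Y be two such fixed points and D = Y - X.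
Nearness of Y gives 2⟪Z_Y - Y, X - Y⟫ ≤ ‖D‖². The singular value gap at Z_X sharpens the analogous
bound to 2⟪Z_X - X, D⟫ ≤ c‖D‖² with c < 1 - 2δ_{2K} (`two_inner_residual_le`). Adding the two yields
2‖AD‖² ≤ (1 + c)‖D‖², whereas rank D ≤ 2K gives 2‖AD‖² ≥ 2(1 - δ_{2K})‖D‖², so D = 0. -/

namespace LowRank

open Filter Topology

/-! ### The quadratic envelope of the indicator of a closed set. -/

section Envelope

variable {V : Type*} [NormedAddCommGroup V] [InnerProductSpace ℝ V] {C : Set V}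

/-- `sup_{W ∈ C} (2⟪Z, W⟫ - ‖W‖²)`, expressed through the distance to `C`. -/
noncomputable def projGain (C : Set V) (Z : V) : ℝ :=
  ‖Z‖ ^ 2 - Metric.infDist Z C ^ 2

/-- The convex envelope of `‖·‖²` restricted to `C`. -/
noncomputable def convEnvelope (C : Set V) (X : V) : ℝ :=
  ⨆ Y : V, (2 * inner ℝ X Y - projGain C Y)

/-- Boundedness of the suprema defining `convEnvelope`, i.e. finiteness of the envelope. -/
def EnvelopeFinite (C : Set V) (X : V) : Prop :=
  BddAbove (Set.range fun Y : V => 2 * inner ℝ X Y - projGain C Y)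

theorem le_projGain {W : V} (hW : W ∈ C) (Z : V) :
    2 * inner ℝ Z W - ‖W‖ ^ 2 ≤ projGain C Z := by
  have h1 : Metric.infDist Z C ≤ ‖Z - W‖ := by
    rw [← dist_eq_norm]; exact Metric.infDist_le_dist_of_mem hW
  have h2 : Metric.infDist Z C ^ 2 ≤ ‖Z - W‖ ^ 2 :=
    pow_le_pow_left₀ Metric.infDist_nonneg h1 2
  rw [norm_sub_sq_real] at h2
  unfold projGain
  linarith

theorem exists_projGain_eq [FiniteDimensional ℝ V] (hC : IsClosed C) (hne : C.Nonempty) (Z : V) :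
    ∃ W ∈ C, 2 * inner ℝ Z W - ‖W‖ ^ 2 = projGain C Z := by
  have : ProperSpace V := FiniteDimensional.proper ℝ V
  obtain ⟨W, hW, h⟩ := hC.exists_infDist_eq_dist hne Z
  refine ⟨W, hW, ?_⟩
  rw [projGain, h, dist_eq_norm, norm_sub_sq_real]
  ring

theorem le_convEnvelope {X : V} (hX : EnvelopeFinite C X) (Y : V) :
    2 * inner ℝ X Y - projGain C Y ≤ convEnvelope C X :=
  le_ciSup hX Y

theorem convEnvelope_le_norm_sq {W : V} (hW : W ∈ C) : convEnvelope C W ≤ ‖W‖ ^ 2 := by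
  refine ciSup_le fun Y => ?_
  have := le_projGain hW Y
  rw [real_inner_comm] at this
  linarith

theorem convEnvelope_segment_le {X Y : V} (hX : EnvelopeFinite C X) (hY : EnvelopeFinite C Y)
    {t : ℝ} (h0 : 0 ≤ t) (h1 : t ≤ 1) :
    convEnvelope C (X + t • (Y - X)) ≤ (1 - t) * convEnvelope C X + t * convEnvelope C Y := by
  refine ciSup_le fun U => ?_
  have hx := mul_le_mul_of_nonneg_left (le_convEnvelope hX U) (sub_nonneg.2 h1)
  have hy := mul_le_mul_of_nonneg_left (le_convEnvelope hY U) h0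
  rw [inner_add_left, real_inner_smul_left, inner_sub_left]
  linarith

theorem envelopeFinite_of_mem {W : V} (hW : W ∈ C) : EnvelopeFinite C W := by
  refine ⟨‖W‖ ^ 2, ?_⟩
  rintro _ ⟨Y, rfl⟩
  have := le_projGain hW Y
  rw [real_inner_comm] at this
  simp only
  linarith

theorem EnvelopeFinite.midpoint {X Y : V} (hX : EnvelopeFinite C X) (hY : EnvelopeFinite C Y) :
    EnvelopeFinite C ((2⁻¹ : ℝ) • (X + Y)) := by
  obtain ⟨M, hM⟩ := hX
  obtain ⟨N, hN⟩ := hY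
  refine ⟨2⁻¹ * (M + N), ?_⟩
  rintro _ ⟨U, rfl⟩
  have h1 := hM ⟨U, rfl⟩
  have h2 := hN ⟨U, rfl⟩
  simp only [real_inner_smul_left, inner_add_left] at h1 h2 ⊢
  linarith

/-- Points outside C contribute -∞, so the supremum is minus the squared distance to C, attained at
a nearest point. -/
theorem quadTransform_indicator [FiniteDimensional ℝ V] (hC : IsClosed C) (hne : C.Nonempty)
    {f : V → EReal} (hf0 : ∀ X ∈ C, f X = 0) (hf1 : ∀ X ∉ C, f X = ⊤) (Y : V) :
    quadTransform 2 f Y =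
      ((projGain C Y - ‖Y‖ ^ 2 : ℝ) : EReal) := by
  refine le_antisymm (iSup_le fun X => ?_) ?_
  · by_cases hX : X ∈ C
    · have := le_projGain hX Y
      rw [hf0 X hX, neg_zero, zero_sub, ← EReal.coe_neg, EReal.coe_le_coe_iff, norm_sub_sq_real,
        real_inner_comm]
      linarith
    · rw [hf1 X hX, EReal.neg_top, EReal.bot_sub]
      exact bot_le
  · obtain ⟨W, hW, h⟩ := exists_projGain_eq hC hne Y
    refine le_iSup_of_le W ?_
    rw [hf0 W hW, neg_zero, zero_sub, ← EReal.coe_neg, EReal.coe_le_coe_iff, norm_sub_sq_real,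
      real_inner_comm]
    linarith

theorem quadEnvelope_indicator [FiniteDimensional ℝ V] (hC : IsClosed C) (hne : C.Nonempty)
    {f : V → EReal} (hf0 : ∀ X ∈ C, f X = 0) (hf1 : ∀ X ∉ C, f X = ⊤)
    {X : V} (hX : EnvelopeFinite C X) :
    quadEnvelope 2 f X =
      ((convEnvelope C X - ‖X‖ ^ 2 : ℝ) : EReal) := by
  have key : ∀ Y : V, -quadTransform 2 f Y -
      ((2 / 2 * ‖Y - X‖ ^ 2 : ℝ) : EReal) =
        ((2 * inner ℝ X Y - projGain C Y - ‖X‖ ^ 2 : ℝ) : EReal) := fun Y => by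
    rw [quadTransform_indicator hC hne hf0 hf1, ← EReal.coe_neg, ← EReal.coe_sub, EReal.coe_eq_coe_iff,
      norm_sub_sq_real, real_inner_comm]
    ring
  rw [quadEnvelope, quadTransform]
  simp only [key]
  refine le_antisymm (iSup_le fun Y => ?_) ?_
  · rw [EReal.coe_le_coe_iff]
    linarith [le_convEnvelope hX Y]
  -- A real number strictly between the two sides would bound every term of the real supremum,
  -- contradicting its minimality.
  · by_contra! hlt
    obtain ⟨r, hr1, hr2⟩ := EReal.lt_iff_exists_real_btwn.1 hlt
    rw [EReal.coe_lt_coe_iff] at hr2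
    have : convEnvelope C X ≤ r + ‖X‖ ^ 2 := by
      refine ciSup_le fun Y => ?_
      have h := (le_iSup (fun Y : V =>
        ((2 * inner ℝ X Y - projGain C Y - ‖X‖ ^ 2 : ℝ) : EReal)) Y).trans hr1.le
      rw [EReal.coe_le_coe_iff] at h
      linarith
    linarith

end Envelope

/-! ### Global and local minimizers of the relaxed least squares objective. -/

section LeastSquares

variable {V E : Type*} [NormedAddCommGroup V] [InnerProductSpace ℝ V] [FiniteDimensional ℝ V]
  [NormedAddCommGroup E] [InnerProductSpace ℝ E] [FiniteDimensional ℝ E] {C : Set V}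

/-- The convex envelope of `‖·‖²` on `C` plus the concave part `‖A X - b‖² - ‖X‖²`. -/
noncomputable def envObjective (A : V →ₗ[ℝ] E) (b : E) (C : Set V) (X : V) : ℝ :=
  convEnvelope C X - ‖X‖ ^ 2 + ‖A X - b‖ ^ 2

/-- The gradient step `(I - A⋆A) X + A⋆ b`. -/
noncomputable def gradStep (A : V →ₗ[ℝ] E) (b : E) (X : V) : V :=
  (X - LinearMap.adjoint A (A X)) + LinearMap.adjoint A b

/-- The Taylor expansion of a quadratic is exact. Its last term is nonpositive when A is
nonexpansive, which is the concavity used below. -/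
theorem residual_expansion (A : V →ₗ[ℝ] E) (b : E) (X D : V) :
    ‖A (X + D) - b‖ ^ 2 - ‖X + D‖ ^ 2 =
      ‖A X - b‖ ^ 2 - ‖X‖ ^ 2 - 2 * inner ℝ (gradStep A b X) D + (‖A D‖ ^ 2 - ‖D‖ ^ 2) := by
  have h : A (X + D) - b = (A X - b) + A D := by rw [map_add]; abel
  rw [h, norm_add_sq_real, norm_add_sq_real, gradStep, inner_add_left, inner_sub_left,
    inner_sub_left, LinearMap.adjoint_inner_left, LinearMap.adjoint_inner_left]
  ring

theorem inner_gradStep_sub (A : V →ₗ[ℝ] E) (b : E) (X Y : V) :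
    inner ℝ (gradStep A b Y - gradStep A b X) (Y - X) = ‖Y - X‖ ^ 2 - ‖A (Y - X)‖ ^ 2 := by
  have h : gradStep A b Y - gradStep A b X =
      (Y - X) - LinearMap.adjoint A (A (Y - X)) := by
    simp only [gradStep, map_sub]; abel
  rw [h, inner_sub_left, LinearMap.adjoint_inner_left, real_inner_self_eq_norm_sq,
    real_inner_self_eq_norm_sq]

/-- Minimizing the least squares term over `C` minimizes the relaxed objective. -/
theorem envObjective_le_of_isMinOn {A : V →ₗ[ℝ] E} {b : E} (hA : ∀ X, ‖A X‖ ≤ ‖X‖)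
    (hC : IsClosed C) (hne : C.Nonempty) (hfin : ∀ X, EnvelopeFinite C X) {X₀ : V} (hX₀ : X₀ ∈ C)
    (hmin : ∀ W ∈ C, ‖A X₀ - b‖ ^ 2 ≤ ‖A W - b‖ ^ 2) (X : V) :
    envObjective A b C X₀ ≤ envObjective A b C X := by
  -- With Z = `gradStep A b X` as test point the envelope at X is bounded below. Concavity along W -
  -- X then shows that the objective at X is at least ‖AW - b‖².
  obtain ⟨W, hW, h⟩ := exists_projGain_eq hC hne (gradStep A b X)
  have h1 := hmin W hW
  have h2 := residual_expansion A b X (W - X)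
  have h3 := pow_le_pow_left₀ (norm_nonneg _) (hA (W - X)) 2
  have h4 := le_convEnvelope (hfin X) (gradStep A b X)
  have h5 := convEnvelope_le_norm_sq hX₀
  rw [add_sub_cancel, inner_sub_right] at h2
  rw [real_inner_comm] at h4
  unfold envObjective
  linarith

/-- A local minimizer of the relaxed objective is a point of `C` nearest to its gradient step. -/
theorem isNearest_of_isLocalMin {A : V →ₗ[ℝ] E} {b : E} (hA : ∀ X, X ≠ 0 → ‖A X‖ < ‖X‖)
    (hC : IsClosed C) (hne : C.Nonempty) (hfin : ∀ X, EnvelopeFinite C X) {Y : V}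
    (hY : IsLocalMin (envObjective A b C) Y) :
    Y ∈ C ∧ 2 * inner ℝ (gradStep A b Y) Y - ‖Y‖ ^ 2 = projGain C (gradStep A b Y) := by
  obtain ⟨W, hW, h⟩ := exists_projGain_eq hC hne (gradStep A b Y)
  suffices hWY : W = Y by subst hWY; exact ⟨hW, h⟩
  by_contra hWY
  have hcont : Tendsto (fun t : ℝ => Y + t • (W - Y)) (𝓝[>] 0) (𝓝 Y) := by
    have : ContinuousAt (fun t : ℝ => Y + t • (W - Y)) 0 := by fun_prop
    simpa [ContinuousAt] using this.tendsto.mono_left nhdsWithin_le_nhds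
  have hle : ∀ᶠ t : ℝ in 𝓝[>] 0, t < 1 :=
    (eventually_lt_nhds one_pos).filter_mono nhdsWithin_le_nhds
  -- Along the segment to W the convex part and the linear term together do not increase, and the
  -- quadratic term is strictly negative for every t in (0, 1). So small t contradict local
  -- minimality.
  obtain ⟨t, hmin, ht1, ht0⟩ :=
    ((hcont.eventually hY).and (hle.and self_mem_nhdsWithin)).exists
  replace ht0 : 0 < t := ht0
  have h1 := convEnvelope_segment_le (hfin Y) (hfin W) ht0.le ht1.le
  have h2 := residual_expansion A b Y (t • (W - Y))
  have h3 := mul_le_mul_of_nonneg_left (convEnvelope_le_norm_sq hW) ht0.le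
  have h4 := mul_le_mul_of_nonneg_left (le_convEnvelope (hfin Y) (gradStep A b Y)) ht0.le
  have h5 : ‖A (t • (W - Y))‖ ^ 2 < ‖t • (W - Y)‖ ^ 2 :=
    pow_lt_pow_left₀ (hA _ (smul_ne_zero ht0.ne' (sub_ne_zero.2 hWY))) (norm_nonneg _) two_ne_zero
  rw [real_inner_smul_right, inner_sub_right] at h2
  rw [real_inner_comm, ← h] at h4
  unfold envObjective at hmin
  linarith

end LeastSquares

/-! ### Fractional selection of the largest weights. -/

section Selection

variable {ι : Type*} [Fintype ι] [DecidableEq ι] {μ p : ι → ℝ} {I : Finset ι} {τ : ℝ}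

/-- Here τ is a Lagrange multiplier for the constraint ∑ p ≤ #I. When τ separates the weights every
summand on the right is nonnegative, which gives both optimality of I and, for strict separation,
the equality case. -/
theorem sum_selection_sub (μ p : ι → ℝ) (I : Finset ι) (τ : ℝ) :
    ∑ i ∈ I, μ i - ∑ i, μ i * p i =
      ∑ i, (if i ∈ I then (μ i - τ) * (1 - p i) else (τ - μ i) * p i) +
        τ * (I.card - ∑ i, p i) := by
  have h : ∀ i, (if i ∈ I then (μ i - τ) * (1 - p i) else (τ - μ i) * p i) =
      (if i ∈ I then μ i else 0) - μ i * p i - τ * (if i ∈ I then 1 else 0) + τ * p i := by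
    intro i
    split_ifs <;> ring
  simp only [h, Finset.sum_add_distrib, Finset.sum_sub_distrib, ← Finset.mul_sum]
  simp
  ring

theorem sum_mul_le_sum_selection (hτ : 0 ≤ τ) (hI : ∀ i ∈ I, τ ≤ μ i) (hI' : ∀ i ∉ I, μ i ≤ τ)
    (h0 : ∀ i, 0 ≤ p i) (h1 : ∀ i, p i ≤ 1) (hp : ∑ i, p i ≤ I.card) :
    ∑ i, μ i * p i ≤ ∑ i ∈ I, μ i := by
  rw [← sub_nonneg, sum_selection_sub μ p I τ]
  refine add_nonneg (Finset.sum_nonneg fun i _ => ?_) (mul_nonneg hτ (sub_nonneg.2 hp))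
  split_ifs with hi
  · exact mul_nonneg (sub_nonneg.2 (hI i hi)) (sub_nonneg.2 (h1 i))
  · exact mul_nonneg (sub_nonneg.2 (hI' i hi)) (h0 i)

theorem eq_indicator_of_sum_selection_le (hτ : 0 ≤ τ) (hI : ∀ i ∈ I, τ < μ i)
    (hI' : ∀ i ∉ I, μ i < τ) (h0 : ∀ i, 0 ≤ p i) (h1 : ∀ i, p i ≤ 1) (hp : ∑ i, p i ≤ I.card)
    (h : ∑ i ∈ I, μ i ≤ ∑ i, μ i * p i) (i : ι) : p i = if i ∈ I then 1 else 0 := by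
  have hnn : ∀ i ∈ Finset.univ,
      0 ≤ (if i ∈ I then (μ i - τ) * (1 - p i) else (τ - μ i) * p i) := by
    intro i _
    split_ifs with hi
    · exact mul_nonneg (sub_nonneg.2 (hI i hi).le) (sub_nonneg.2 (h1 i))
    · exact mul_nonneg (sub_nonneg.2 (hI' i hi).le) (h0 i)
  have hz := sum_selection_sub μ p I τ
  have hc := mul_nonneg hτ (sub_nonneg.2 hp)
  have hs := Finset.sum_nonneg hnn
  have h2 := (Finset.sum_eq_zero_iff_of_nonneg hnn).1 (by linarith) i (Finset.mem_univ i)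
  split_ifs at h2 ⊢ with hi
  · have := (mul_eq_zero.1 h2).resolve_left (sub_pos.2 (hI i hi)).ne'
    linarith
  · exact (mul_eq_zero.1 h2).resolve_left (sub_pos.2 (hI' i hi)).ne'

end Selection

/-! ### Energy identities for orthogonal projections. -/

section Projection

variable {𝕜 V W ι : Type*} [RCLike 𝕜] [NormedAddCommGroup V] [InnerProductSpace 𝕜 V]
  [FiniteDimensional 𝕜 V] [NormedAddCommGroup W] [InnerProductSpace 𝕜 W]
  [Fintype ι]

open scoped InnerProductSpace

theorem apply_starProjection_ker_orthogonal (T : V →ₗ[𝕜] W) (x : V) :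
    T ((LinearMap.ker T)ᗮ.starProjection x) = T x := by
  have h := (LinearMap.ker T)ᗮ.sub_starProjection_mem_orthogonal x
  rw [Submodule.orthogonal_orthogonal, LinearMap.mem_ker, map_sub, sub_eq_zero] at h
  exact h.symm

variable [FiniteDimensional 𝕜 W]

/-- Both sides are traces, of S⋆TP and PS⋆T, so cyclicity of the trace applies. P need not commute
with anything. -/
theorem sum_inner_comp_symmetric (v : OrthonormalBasis ι 𝕜 V) (S T : V →ₗ[𝕜] W) {P : V →ₗ[𝕜] V}
    (hP : P.IsSymmetric) :
    ∑ i, ⟪S (v i), T (P (v i))⟫_𝕜 = ∑ i, ⟪S (P (v i)), T (v i)⟫_𝕜 := by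
  have h1 : ∑ i, ⟪S (v i), T (P (v i))⟫_𝕜 =
      LinearMap.trace 𝕜 V ((LinearMap.adjoint S ∘ₗ T) * P) := by
    rw [LinearMap.trace_eq_sum_inner _ v]
    simp [LinearMap.adjoint_inner_right]
  have h2 : ∑ i, ⟪S (P (v i)), T (v i)⟫_𝕜 =
      LinearMap.trace 𝕜 V (P * (LinearMap.adjoint S ∘ₗ T)) := by
    rw [LinearMap.trace_eq_sum_inner _ v]
    refine Finset.sum_congr rfl fun i _ => ?_
    rw [Module.End.mul_apply, ← hP, LinearMap.comp_apply, LinearMap.adjoint_inner_right]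
  rw [h1, h2, LinearMap.trace_mul_comm]

theorem inner_starProjection_self (U : Submodule 𝕜 V) (x : V) :
    ⟪x, U.starProjection x⟫_𝕜 = ((‖U.starProjection x‖ ^ 2 : ℝ) : 𝕜) := by
  have h := U.starProjection_inner_eq_zero x _ (U.starProjection_apply_mem x)
  rw [inner_sub_left, sub_eq_zero] at h
  rw [h, inner_self_eq_norm_sq_to_K]
  norm_cast

theorem sum_norm_sq_starProjection (v : OrthonormalBasis ι 𝕜 V) (U : Submodule 𝕜 V) :
    ∑ i, ‖U.starProjection (v i)‖ ^ 2 = Module.finrank 𝕜 U := by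
  have hP : LinearMap.IsProj U (U.starProjection : V →ₗ[𝕜] V) :=
    ⟨fun x => U.starProjection_apply_mem x, fun x hx =>
      Submodule.starProjection_eq_self_iff.2 hx⟩
  have h := hP.trace
  rw [LinearMap.trace_eq_sum_inner _ v] at h
  have h2 : ∀ i, ⟪v i, (U.starProjection : V →ₗ[𝕜] V) (v i)⟫_𝕜 =
      ((‖U.starProjection (v i)‖ ^ 2 : ℝ) : 𝕜) := fun i => inner_starProjection_self U (v i)
  simp only [h2] at h
  exact_mod_cast h

/-- Since T = TP for the projection P onto U, N may be replaced by NP in the cross term. Completing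
the square leaves ‖NP‖², which is ∑ μ i ‖P (v i)‖² because v diagonalizes N⋆N. -/
theorem sum_energy_eq (v : OrthonormalBasis ι 𝕜 V) [DecidableEq ι] (N T : V →ₗ[𝕜] W) {μ : ι → ℝ}
    (hN : ∀ i j, ⟪N (v i), N (v j)⟫_𝕜 = if i = j then (μ i : 𝕜) else 0) {U : Submodule 𝕜 V}
    (hT : ∀ x, T (U.starProjection x) = T x) :
    ∑ i, (2 * RCLike.re ⟪N (v i), T (v i)⟫_𝕜 - ‖T (v i)‖ ^ 2) =
      ∑ i, μ i * ‖U.starProjection (v i)‖ ^ 2 -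
        ∑ i, ‖N (U.starProjection (v i)) - T (v i)‖ ^ 2 := by
  have hP : (U.starProjection : V →ₗ[𝕜] V).IsSymmetric := U.starProjection_isSymmetric
  have h1 : ∑ i, ⟪N (v i), T (v i)⟫_𝕜 = ∑ i, ⟪N (U.starProjection (v i)), T (v i)⟫_𝕜 := by
    have := sum_inner_comp_symmetric v N T hP
    simpa only [ContinuousLinearMap.coe_coe, hT] using this
  have hNN : ∀ i, LinearMap.adjoint N (N (v i)) = (μ i : 𝕜) • v i := fun i => by
    refine v.repr.injective (PiLp.ext fun j => ?_)
    rw [v.repr_apply_apply, v.repr_apply_apply, LinearMap.adjoint_inner_right, hN,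
      inner_smul_right, orthonormal_iff_ite.1 v.orthonormal]
    split_ifs with h
    · rw [h, mul_one]
    · rw [mul_zero]
  have h2 : ∑ i, ‖N (U.starProjection (v i))‖ ^ 2 =
      ∑ i, μ i * ‖U.starProjection (v i)‖ ^ 2 := by
    have h := sum_inner_comp_symmetric v (N ∘ₗ (U.starProjection : V →ₗ[𝕜] V)) N hP
    have hPP : ∀ x, U.starProjection (U.starProjection x) = U.starProjection x := fun x =>
      Submodule.starProjection_eq_self_iff.2 (U.starProjection_apply_mem x)
    simp only [LinearMap.comp_apply, ContinuousLinearMap.coe_coe, hPP] at h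
    have h3 : ∀ i, ⟪N (U.starProjection (v i)), N (v i)⟫_𝕜 =
        ((μ i * ‖U.starProjection (v i)‖ ^ 2 : ℝ) : 𝕜) := fun i => by
      rw [← LinearMap.adjoint_inner_right, hNN, inner_smul_right,
        Submodule.inner_starProjection_left_eq_right, inner_starProjection_self]
      norm_cast
    have h4 : ∀ i, ⟪N (U.starProjection (v i)), N (U.starProjection (v i))⟫_𝕜 =
        ((‖N (U.starProjection (v i))‖ ^ 2 : ℝ) : 𝕜) := fun i => by
      rw [inner_self_eq_norm_sq_to_K]
      norm_cast
    simp only [h3, h4] at h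
    exact_mod_cast h
  have h1' := congrArg RCLike.re h1
  rw [map_sum, map_sum] at h1'
  simp only [norm_sub_sq (𝕜 := 𝕜), Finset.sum_add_distrib, Finset.sum_sub_distrib,
    ← Finset.mul_sum, h1', h2]
  ring

end Projection

/-! ### Frobenius geometry and the set of matrices of bounded rank. -/

section Matrices

variable {𝕜 : Type*} [RCLike 𝕜] {m n : ℕ}

open scoped InnerProductSpace

theorem inner_eq_sum_basis {ι : Type*} [Fintype ι]
    (v : OrthonormalBasis ι 𝕜 (EuclideanSpace 𝕜 (Fin n))) (X Y : Matrix (Fin m) (Fin n) 𝕜) :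
    inner ℝ X Y =
      ∑ i, RCLike.re ⟪Matrix.toEuclideanLin X (v i), Matrix.toEuclideanLin Y (v i)⟫_𝕜 := by
  have h : Matrix.trace (Xᴴ * Y) =
      ∑ i, ⟪Matrix.toEuclideanLin X (v i), Matrix.toEuclideanLin Y (v i)⟫_𝕜 := by
    have h2 : Matrix.trace (Xᴴ * Y) = LinearMap.trace 𝕜 _
        (LinearMap.adjoint (Matrix.toEuclideanLin X) ∘ₗ Matrix.toEuclideanLin Y) := by
      rw [← Matrix.toEuclideanLin_conjTranspose_eq_adjoint,
        Matrix.toEuclideanLin_eq_toLin_orthonormal, Matrix.toEuclideanLin_eq_toLin_orthonormal, ← Matrix.toLin_mul,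
        Matrix.trace_toLin_eq]
    rw [h2, LinearMap.trace_eq_sum_inner _ v]
    simp only [LinearMap.comp_apply, LinearMap.adjoint_inner_right]
  change RCLike.re (Matrix.trace (Xᴴ * Y)) = _
  rw [h, map_sum]

theorem rank_eq_finrank_toEuclideanLin (X : Matrix (Fin m) (Fin n) 𝕜) :
    X.rank = Module.finrank 𝕜 (LinearMap.range (Matrix.toEuclideanLin X)) := by
  rw [Matrix.toEuclideanLin_eq_toLin_orthonormal]
  exact Matrix.rank_eq_finrank_range_toLin X _ _

theorem rank_sub_le (X Y : Matrix (Fin m) (Fin n) 𝕜) : (X - Y).rank ≤ X.rank + Y.rank := by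
  simp only [rank_eq_finrank_toEuclideanLin]
  refine (Submodule.finrank_mono ?_).trans (Submodule.finrank_add_le_finrank_add_finrank _ _)
  rintro _ ⟨x, rfl⟩
  rw [map_sub, LinearMap.sub_apply]
  exact Submodule.sub_mem _ (Submodule.mem_sup_left (LinearMap.mem_range_self _ x))
    (Submodule.mem_sup_right (LinearMap.mem_range_self _ x))

theorem isClosed_rank_le (K : ℕ) : IsClosed {X : Matrix (Fin m) (Fin n) 𝕜 | X.rank ≤ K} := by
  let L : Matrix (Fin m) (Fin n) 𝕜 →ₗ[𝕜] (EuclideanSpace 𝕜 (Fin n) →L[𝕜] EuclideanSpace 𝕜 (Fin m)) :=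
    (Matrix.toEuclideanLin ≪≫ₗ LinearMap.toContinuousLinearMap).toLinearMap
  have hL : Continuous L := L.continuous_of_finiteDimensional
  have h := (isOpen_setOfPred_nat_le_rank (𝕜 := 𝕜) (E := EuclideanSpace 𝕜 (Fin n))
    (F := EuclideanSpace 𝕜 (Fin m)) (K + 1)).preimage hL
  convert h.isClosed_compl using 1
  ext X
  -- Rank at least K + 1 is an open condition on operators, and rank at most K is its negation.
  simp only [Set.mem_ofPred_eq, Set.mem_compl_iff, Set.mem_preimage, not_le]
  rw [rank_eq_finrank_toEuclideanLin, LinearMap.rank, ← Module.finrank_eq_rank, Nat.cast_lt,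
    Nat.lt_succ_iff]
  rfl

theorem rank_le_nonempty (K : ℕ) : {X : Matrix (Fin m) (Fin n) 𝕜 | X.rank ≤ K}.Nonempty :=
  ⟨0, by simp [Matrix.rank_zero]⟩

theorem rank_single_le (i : Fin m) (j : Fin n) (x : 𝕜) : (Matrix.single i j x).rank ≤ 1 := by
  have : Matrix.single i j x = Matrix.vecMulVec (Pi.single i x) (Pi.single j 1) := by
    ext a b
    by_cases hi : i = a <;> by_cases hj : j = b <;>
      simp [Matrix.single, Matrix.vecMulVec, Pi.single_apply, hi, hj, eq_comm]
  rw [this]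
  exact Matrix.rank_vecMulVec_le _ _

/-- Finiteness is preserved by midpoints and holds on C, which contains all matrices with a single
nonzero entry because K ≥ 1. Every matrix is a sum of these. The scalar t absorbs the factor 2 in
writing a sum as a midpoint. -/
theorem envelopeFinite_rank_le {K : ℕ} (hK : 1 ≤ K) (X : Matrix (Fin m) (Fin n) 𝕜) :
    EnvelopeFinite {X : Matrix (Fin m) (Fin n) 𝕜 | X.rank ≤ K} X := by
  suffices h : ∀ t : ℝ, EnvelopeFinite {X : Matrix (Fin m) (Fin n) 𝕜 | X.rank ≤ K} (t • X) by
    simpa using h 1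
  induction X using Matrix.induction_on' with
  | h_zero => exact fun t => envelopeFinite_of_mem (by simp)
  | h_add p q hp hq =>
    intro t
    have := (hp (2 * t)).midpoint (hq (2 * t))
    rwa [← smul_add, smul_smul, ← mul_assoc, inv_mul_cancel₀ two_ne_zero, one_mul] at this
  | h_std_basis i j x =>
    intro t
    rw [Matrix.smul_single]
    exact envelopeFinite_of_mem ((rank_single_le i j _).trans hK)

end Matrices

/-! ### Best approximation of bounded rank, with its equality case. -/

section EckartYoung

variable {𝕜 : Type*} [RCLike 𝕜] {m n : ℕ}

open scoped InnerProductSpace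

theorem norm_sq_eq_sum_basis {ι : Type*} [Fintype ι]
    (v : OrthonormalBasis ι 𝕜 (EuclideanSpace 𝕜 (Fin n))) (X : Matrix (Fin m) (Fin n) 𝕜) :
    ‖X‖ ^ 2 = ∑ i, ‖Matrix.toEuclideanLin X (v i)‖ ^ 2 := by
  rw [← real_inner_self_eq_norm_sq, inner_eq_sum_basis v]
  exact Finset.sum_congr rfl fun i _ => inner_self_eq_norm_sq _

theorem two_inner_sub_norm_sq_eq {ι : Type*} [Fintype ι]
    (v : OrthonormalBasis ι 𝕜 (EuclideanSpace 𝕜 (Fin n))) (X Y : Matrix (Fin m) (Fin n) 𝕜) :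
    2 * inner ℝ X Y - ‖Y‖ ^ 2 =
      ∑ i, (2 * RCLike.re ⟪Matrix.toEuclideanLin X (v i), Matrix.toEuclideanLin Y (v i)⟫_𝕜 -
        ‖Matrix.toEuclideanLin Y (v i)‖ ^ 2) := by
  rw [inner_eq_sum_basis v, norm_sq_eq_sum_basis v, Finset.sum_sub_distrib, Finset.mul_sum]

/-- The orthogonal projection onto the row space of `W`. -/
noncomputable def rowProj (W : Matrix (Fin m) (Fin n) 𝕜) :
    EuclideanSpace 𝕜 (Fin n) →L[𝕜] EuclideanSpace 𝕜 (Fin n) :=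
  (LinearMap.ker (Matrix.toEuclideanLin W))ᗮ.starProjection

theorem sum_norm_sq_rowProj {ι : Type*} [Fintype ι]
    (v : OrthonormalBasis ι 𝕜 (EuclideanSpace 𝕜 (Fin n))) (W : Matrix (Fin m) (Fin n) 𝕜) :
    ∑ i, ‖rowProj W (v i)‖ ^ 2 = W.rank := by
  unfold rowProj
  rw [sum_norm_sq_starProjection, rank_eq_finrank_toEuclideanLin]
  have h1 := (LinearMap.ker (Matrix.toEuclideanLin W)).finrank_add_finrank_orthogonal
  have h2 := (Matrix.toEuclideanLin W).finrank_range_add_finrank_ker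
  congr 1
  omega

theorem norm_sq_rowProj_le_one {ι : Type*} [Fintype ι]
    (v : OrthonormalBasis ι 𝕜 (EuclideanSpace 𝕜 (Fin n))) (W : Matrix (Fin m) (Fin n) 𝕜) (i : ι) :
    ‖rowProj W (v i)‖ ^ 2 ≤ 1 := by
  have h : ‖rowProj W (v i)‖ ≤ ‖v i‖ := Submodule.norm_starProjection_apply_le _ _
  rw [v.norm_eq_one] at h
  exact pow_le_one₀ (norm_nonneg _) h

theorem toEuclideanLin_real_smul (r : ℝ) (X : Matrix (Fin m) (Fin n) 𝕜)
    (x : EuclideanSpace 𝕜 (Fin n)) :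
    Matrix.toEuclideanLin (r • X) x = (r : 𝕜) • Matrix.toEuclideanLin X x := by
  have h : r • X = (r : 𝕜) • X := by
    ext i j
    simp [RCLike.real_smul_eq_coe_mul]
  rw [h, map_smul, LinearMap.smul_apply]

theorem exists_rank_le_apply_eq {ι : Type*} [Fintype ι] [DecidableEq ι]
    (v : OrthonormalBasis ι 𝕜 (EuclideanSpace 𝕜 (Fin n))) (z : ι → EuclideanSpace 𝕜 (Fin m))
    (I : Finset ι) :
    ∃ W : Matrix (Fin m) (Fin n) 𝕜, W.rank ≤ I.card ∧
      ∀ i, Matrix.toEuclideanLin W (v i) = if i ∈ I then z i else 0 := by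
  obtain ⟨T, hT⟩ : ∃ T : EuclideanSpace 𝕜 (Fin n) →ₗ[𝕜] EuclideanSpace 𝕜 (Fin m),
      T = v.toBasis.constr 𝕜 fun i => if i ∈ I then z i else 0 := ⟨_, rfl⟩
  obtain ⟨W, hW⟩ : ∃ W : Matrix (Fin m) (Fin n) 𝕜, Matrix.toEuclideanLin W = T :=
    Matrix.toEuclideanLin.surjective T
  refine ⟨W, ?_, fun i => ?_⟩
  · rw [rank_eq_finrank_toEuclideanLin, hW, hT, v.toBasis.constr_range]
    have hle : Submodule.span 𝕜 (Set.range fun i => if i ∈ I then z i else 0) ≤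
        Submodule.span 𝕜 (Set.range fun i : I => z i) := by
      rw [Submodule.span_le]
      rintro _ ⟨i, rfl⟩
      simp only
      split_ifs with hi
      · exact Submodule.subset_span ⟨⟨i, hi⟩, rfl⟩
      · exact Submodule.zero_mem _
    have hcard := finrank_range_le_card (R := 𝕜) fun i : I => z i
    rw [Fintype.card_coe] at hcard
    exact (Submodule.finrank_mono hle).trans hcard
  · have := v.toBasis.constr_basis 𝕜 (fun i => if i ∈ I then z i else 0) i
    rw [hW, hT]
    rwa [v.coe_toBasis] at this

/-- If `X` is a best approximation of `Z` of rank at most `#I`, and `v` is an eigenbasis of `Z⋆Z`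
whose eigenvalues over `I` strictly dominate the others, then `X` is the truncation of `Z`
to the eigenvectors over `I`. -/
theorem apply_eq_of_best_approx {ι : Type*} [Fintype ι] [DecidableEq ι]
    (v : OrthonormalBasis ι 𝕜 (EuclideanSpace 𝕜 (Fin n))) {Z X : Matrix (Fin m) (Fin n) 𝕜}
    {μ : ι → ℝ} {I : Finset ι} {τ : ℝ}
    (hZ : ∀ i j, ⟪Matrix.toEuclideanLin Z (v i), Matrix.toEuclideanLin Z (v j)⟫_𝕜 =
      if i = j then (μ i : 𝕜) else 0)
    (hτ : 0 ≤ τ) (hI : ∀ i ∈ I, τ < μ i) (hI' : ∀ i ∉ I, μ i < τ) (hX : X.rank ≤ I.card)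
    (hbest : ∀ W : Matrix (Fin m) (Fin n) 𝕜, W.rank ≤ I.card →
      2 * inner ℝ Z W - ‖W‖ ^ 2 ≤ 2 * inner ℝ Z X - ‖X‖ ^ 2) (i : ι) :
    Matrix.toEuclideanLin X (v i) = if i ∈ I then Matrix.toEuclideanLin Z (v i) else 0 := by
  obtain ⟨W, hWrank, hT⟩ :=
    exists_rank_le_apply_eq v (fun i => Matrix.toEuclideanLin Z (v i)) I
  have hμ : ∀ i, ‖Matrix.toEuclideanLin Z (v i)‖ ^ 2 = μ i := fun i => by
    have := hZ i i
    rw [if_pos rfl, inner_self_eq_norm_sq_to_K] at this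
    exact_mod_cast this
  have hWval : 2 * inner ℝ Z W - ‖W‖ ^ 2 = ∑ i ∈ I, μ i := by
    rw [two_inner_sub_norm_sq_eq v, ← Finset.sum_filter_add_sum_filter_not Finset.univ (· ∈ I)]
    have h1 : ∀ i ∈ Finset.univ.filter (· ∈ I),
        2 * RCLike.re ⟪Matrix.toEuclideanLin Z (v i), Matrix.toEuclideanLin W (v i)⟫_𝕜 -
          ‖Matrix.toEuclideanLin W (v i)‖ ^ 2 = μ i := by
      intro i hi
      rw [hT, if_pos (Finset.mem_filter.1 hi).2, inner_self_eq_norm_sq, hμ]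
      ring
    have h2 : ∀ i ∈ Finset.univ.filter (· ∉ I),
        2 * RCLike.re ⟪Matrix.toEuclideanLin Z (v i), Matrix.toEuclideanLin W (v i)⟫_𝕜 -
          ‖Matrix.toEuclideanLin W (v i)‖ ^ 2 = 0 := by
      intro i hi
      rw [hT, if_neg (Finset.mem_filter.1 hi).2]
      simp
    rw [Finset.sum_congr rfl h1, Finset.sum_congr rfl h2]
    simp
  -- Comparison with the truncation W makes the selection bound tight for the weights ‖P (v i)‖², P
  -- being the row projection of X. These weights are therefore the indicator of I, and the
  -- completed squares vanish, that is X = ZP.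
  have hXval := hbest W hWrank
  rw [hWval, two_inner_sub_norm_sq_eq v,
    sum_energy_eq v _ _ hZ (apply_starProjection_ker_orthogonal (Matrix.toEuclideanLin X))] at hXval
  change _ ≤ ∑ i, μ i * ‖rowProj X (v i)‖ ^ 2 -
    ∑ i, ‖Matrix.toEuclideanLin Z (rowProj X (v i)) - Matrix.toEuclideanLin X (v i)‖ ^ 2 at hXval
  have hp0 : ∀ i, 0 ≤ ‖rowProj X (v i)‖ ^ 2 := fun i => sq_nonneg _
  have hp1 := norm_sq_rowProj_le_one v X
  have hps : ∑ i, ‖rowProj X (v i)‖ ^ 2 ≤ I.card := by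
    rw [sum_norm_sq_rowProj]; exact_mod_cast hX
  have hnn : ∀ i ∈ Finset.univ,
      0 ≤ ‖Matrix.toEuclideanLin Z (rowProj X (v i)) - Matrix.toEuclideanLin X (v i)‖ ^ 2 :=
    fun i _ => sq_nonneg _
  have hub := sum_mul_le_sum_selection hτ (fun i hi => (hI i hi).le) (fun i hi => (hI' i hi).le)
    hp0 hp1 hps
  have hs := Finset.sum_nonneg hnn
  have hp := eq_indicator_of_sum_selection_le hτ hI hI' hp0 hp1 hps (by linarith) i
  have hz := (Finset.sum_eq_zero_iff_of_nonneg hnn).1 (by linarith) i (Finset.mem_univ i)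
  have hXi : Matrix.toEuclideanLin X (v i) = Matrix.toEuclideanLin Z (rowProj X (v i)) := by
    have := norm_eq_zero.1 (pow_eq_zero_iff two_ne_zero |>.1 hz)
    exact (sub_eq_zero.1 this).symm
  rw [hXi]
  split_ifs at hp ⊢ with hi
  · have h1 : ‖rowProj X (v i)‖ = ‖v i‖ := by
      rw [v.norm_eq_one]
      exact (pow_eq_one_iff_of_nonneg (norm_nonneg _) two_ne_zero).1 hp
    have h2 : v i ∈ (LinearMap.ker (Matrix.toEuclideanLin X))ᗮ :=
      (Submodule.mem_iff_norm_starProjection _ _).2 h1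
    have h3 : rowProj X (v i) = v i := Submodule.starProjection_eq_self_iff.2 h2
    rw [h3]
  · rw [norm_eq_zero.1 ((pow_eq_zero_iff two_ne_zero).1 hp), map_zero]

/-- The Eckart–Young bound for matrices of rank at most `#I`. -/
theorem two_inner_sub_norm_sq_le {ι : Type*} [Fintype ι] [DecidableEq ι]
    (v : OrthonormalBasis ι 𝕜 (EuclideanSpace 𝕜 (Fin n))) {N W : Matrix (Fin m) (Fin n) 𝕜}
    {μ : ι → ℝ} {I : Finset ι} {τ : ℝ}
    (hN : ∀ i j, ⟪Matrix.toEuclideanLin N (v i), Matrix.toEuclideanLin N (v j)⟫_𝕜 =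
      if i = j then (μ i : 𝕜) else 0)
    (hτ : 0 ≤ τ) (hI : ∀ i ∈ I, τ ≤ μ i) (hI' : ∀ i ∉ I, μ i ≤ τ) (hW : W.rank ≤ I.card) :
    2 * inner ℝ N W - ‖W‖ ^ 2 ≤ ∑ i ∈ I, μ i := by
  rw [two_inner_sub_norm_sq_eq v,
    sum_energy_eq v _ _ hN (apply_starProjection_ker_orthogonal (Matrix.toEuclideanLin W))]
  have hps : ∑ i, ‖rowProj W (v i)‖ ^ 2 ≤ I.card := by
    rw [sum_norm_sq_rowProj]; exact_mod_cast hW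
  have hub := sum_mul_le_sum_selection hτ hI hI' (fun i => sq_nonneg _)
    (norm_sq_rowProj_le_one v W) hps
  exact (sub_le_self _ (Finset.sum_nonneg fun i _ => sq_nonneg _)).trans hub

/-- A best rank-`K` approximation `X` of `Z` stays one when the residual `Z - X` is
magnified by `c⁻¹`, as long as `σ_{K+1}(Z) ≤ c σ_K(Z)`. -/
theorem two_inner_residual_le {K : ℕ} (hK : 1 ≤ K) {Z X : Matrix (Fin m) (Fin n) 𝕜}
    (hX : X.rank ≤ K)
    (hbest : ∀ W : Matrix (Fin m) (Fin n) 𝕜, W.rank ≤ K →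
      2 * inner ℝ Z W - ‖W‖ ^ 2 ≤ 2 * inner ℝ Z X - ‖X‖ ^ 2)
    {c : ℝ} (hc : 0 < c) (hgap : sigma (K + 1) Z < sigma K Z)
    (hσ : sigma (K + 1) Z ≤ c * sigma K Z) {W : Matrix (Fin m) (Fin n) 𝕜} (hW : W.rank ≤ K) :
    2 * inner ℝ (Z - X) (W - X) ≤ c * ‖W - X‖ ^ 2 := by
  set T := Matrix.toEuclideanLin Z with hT
  have hn : Module.finrank 𝕜 (EuclideanSpace 𝕜 (Fin n)) = n := finrank_euclideanSpace_fin
  let v := T.isSymmetric_adjoint_comp_self.eigenvectorBasis hn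
  have hanti := T.singularValues_antitone
  have hs0 := T.singularValues_nonneg
  have hgap' : T.singularValues K < T.singularValues (K - 1) := hgap
  have hσ' : T.singularValues K ≤ c * T.singularValues (K - 1) := hσ
  -- Otherwise σ_K(Z), stored at index K - 1 ≥ n, would be zero, against the strict gap.
  have hKn : K ≤ n := by
    by_contra! h
    have h1 := T.singularValues_of_finrank_le (i := K - 1) (by rw [hn]; omega)
    linarith [hs0 K]
  have hv : ∀ i j, ⟪T (v i), T (v j)⟫_𝕜 =
      if i = j then ((T.singularValues i ^ 2 : ℝ) : 𝕜) else 0 := by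
    intro i j
    rw [← LinearMap.adjoint_inner_left, ← LinearMap.comp_apply,
      T.isSymmetric_adjoint_comp_self.apply_eigenvectorBasis, inner_smul_left,
      orthonormal_iff_ite.1 v.orthonormal, T.sq_singularValues_fin hn, RCLike.conj_ofReal]
    split_ifs <;> simp
  let I : Finset (Fin n) := Finset.univ.filter fun i => (i : ℕ) < K
  have hmem : ∀ i, i ∈ I ↔ (i : ℕ) < K := fun i => by simp [I]
  have hcard : I.card = K := by
    rw [Fin.card_filter_val_lt, min_eq_right hKn]
  have hbig : ∀ i ∈ I, T.singularValues (K - 1) ≤ T.singularValues i := fun i hi =>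
    hanti (by have := (hmem i).1 hi; omega)
  have hsmall : ∀ i ∉ I, T.singularValues i ≤ T.singularValues K := fun i hi =>
    hanti (by have := mt (hmem i).2 hi; omega)
  have hXv := apply_eq_of_best_approx v (Z := Z) (X := X) (I := I)
    -- The midpoint of the gap separates the eigenvalues strictly, as the equality case requires.
    (τ := ((T.singularValues K + T.singularValues (K - 1)) / 2) ^ 2) hv (sq_nonneg _)
    (fun i hi => pow_lt_pow_left₀ (by linarith [hbig i hi])
      (by linarith [hs0 K, hs0 (K - 1)]) two_ne_zero)
    (fun i hi => pow_lt_pow_left₀ (by linarith [hsmall i hi]) (hs0 i) two_ne_zero)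
    (by rwa [hcard]) (by rwa [hcard])
  have hR : inner ℝ (Z - X) X = 0 := by
    rw [inner_eq_sum_basis v]
    refine Finset.sum_eq_zero fun i _ => ?_
    rw [map_sub, LinearMap.sub_apply, hXv]
    split_ifs <;> simp
  have hXn : ‖X‖ ^ 2 = ∑ i ∈ I, T.singularValues i ^ 2 := by
    rw [norm_sq_eq_sum_basis v, ← Finset.sum_subset (Finset.subset_univ I)]
    · refine Finset.sum_congr rfl fun i hi => ?_
      have := hv i i
      rw [if_pos rfl, inner_self_eq_norm_sq_to_K] at this
      rw [hXv, if_pos hi]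
      exact_mod_cast this
    · intro i _ hi
      rw [hXv, if_neg hi]
      simp
  -- Magnifying the residual keeps the right singular vectors and scales only the singular values
  -- outside I. These remain at most σ_K(Z), so the Eckart–Young bound on this matrix is still ‖X‖².
  have hN : ∀ i, Matrix.toEuclideanLin (X + c⁻¹ • (Z - X)) (v i) =
      ((if i ∈ I then 1 else c⁻¹ : ℝ) : 𝕜) • T (v i) := by
    intro i
    rw [map_add, LinearMap.add_apply, toEuclideanLin_real_smul, map_sub, LinearMap.sub_apply, hXv]
    split_ifs <;> simp [hT]
  have hNμ : ∀ i j, ⟪Matrix.toEuclideanLin (X + c⁻¹ • (Z - X)) (v i),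
      Matrix.toEuclideanLin (X + c⁻¹ • (Z - X)) (v j)⟫_𝕜 =
      if i = j then ((((if i ∈ I then 1 else c⁻¹) * T.singularValues i) ^ 2 : ℝ) : 𝕜) else 0 := by
    intro i j
    rw [hN, hN, inner_smul_left, inner_smul_right, hv, RCLike.conj_ofReal]
    by_cases hij : i = j
    · subst hij
      rw [if_pos rfl, if_pos rfl, ← RCLike.ofReal_mul, ← RCLike.ofReal_mul]
      congr 1
      ring
    · rw [if_neg hij, if_neg hij, mul_zero, mul_zero]
  have hle := two_inner_sub_norm_sq_le v (W := W) (I := I) (τ := T.singularValues (K - 1) ^ 2)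
    hNμ (sq_nonneg _)
    (fun i hi => by
      rw [if_pos hi, one_mul]
      exact pow_le_pow_left₀ (hs0 _) (hbig i hi) 2)
    (fun i hi => by
      rw [if_neg hi]
      refine pow_le_pow_left₀ (mul_nonneg (inv_pos.2 hc).le (hs0 i)) ?_ 2
      rw [inv_mul_le_iff₀ hc]
      exact (hsmall i hi).trans hσ')
    (by rwa [hcard])
  have hsum : ∑ i ∈ I, ((if i ∈ I then 1 else c⁻¹) * T.singularValues i) ^ 2 = ‖X‖ ^ 2 := by
    rw [hXn]
    exact Finset.sum_congr rfl fun i hi => by rw [if_pos hi, one_mul]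
  rw [hsum, inner_add_left, real_inner_smul_left] at hle
  have hfin : c⁻¹ * (2 * inner ℝ (Z - X) W) ≤ ‖W - X‖ ^ 2 := by
    rw [norm_sub_sq_real, real_inner_comm X W]
    linarith
  rw [inv_mul_le_iff₀ hc] at hfin
  rwa [inner_sub_right, hR, sub_zero]

end EckartYoung

/-! ### The lower restricted isometry constant and existence for least squares. -/

section RestrictedIsometry

variable {𝕜 : Type*} [RCLike 𝕜] {m n : ℕ} {E : Type*} [NormedAddCommGroup E]
  [InnerProductSpace ℝ E]

theorem bddBelow_lrip_set (A : Matrix (Fin m) (Fin n) 𝕜 →ₗ[ℝ] E) (k : ℕ) :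
    BddBelow {r : ℝ | ∃ X : Matrix (Fin m) (Fin n) 𝕜,
      X ≠ 0 ∧ X.rank ≤ k ∧ r = ‖A X‖ ^ 2 / ‖X‖ ^ 2} := by
  refine ⟨0, ?_⟩
  rintro _ ⟨X, -, -, rfl⟩
  positivity

theorem one_sub_lrip_mul_le (A : Matrix (Fin m) (Fin n) 𝕜 →ₗ[ℝ] E) {k : ℕ}
    {X : Matrix (Fin m) (Fin n) 𝕜} (hX : X.rank ≤ k) :
    (1 - lrip A k) * ‖X‖ ^ 2 ≤ ‖A X‖ ^ 2 := by
  rcases eq_or_ne X 0 with rfl | h0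
  · simp
  · rw [← le_div_iff₀ (by positivity), lrip, sub_sub_cancel]
    exact csInf_le (bddBelow_lrip_set A k) ⟨X, h0, hX, rfl⟩

theorem lrip_nonneg {A : Matrix (Fin m) (Fin n) 𝕜 →ₗ[ℝ] E} (hA : ∀ X, ‖A X‖ ≤ ‖X‖) (k : ℕ) :
    0 ≤ lrip A k := by
  rw [lrip, sub_nonneg]
  rcases Set.eq_empty_or_nonempty {r : ℝ | ∃ X : Matrix (Fin m) (Fin n) 𝕜,
      X ≠ 0 ∧ X.rank ≤ k ∧ r = ‖A X‖ ^ 2 / ‖X‖ ^ 2} with h | ⟨r, hr⟩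
  · rw [h, Real.sInf_empty]
    exact zero_le_one
  · refine (csInf_le (bddBelow_lrip_set A k) hr).trans ?_
    obtain ⟨X, -, -, rfl⟩ := hr
    exact div_le_one_of_le₀ (pow_le_pow_left₀ (norm_nonneg _) (hA X) 2) (sq_nonneg _)

theorem exists_isMinOn_rank_le {A : Matrix (Fin m) (Fin n) 𝕜 →ₗ[ℝ] E} (b : E) {K : ℕ}
    (h : lrip A K < 1) :
    ∃ X : Matrix (Fin m) (Fin n) 𝕜, X.rank ≤ K ∧
      ∀ W : Matrix (Fin m) (Fin n) 𝕜, W.rank ≤ K → ‖A X - b‖ ^ 2 ≤ ‖A W - b‖ ^ 2 := by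
  have : ProperSpace (Matrix (Fin m) (Fin n) 𝕜) := FiniteDimensional.proper ℝ _
  have hAc : Continuous A := A.continuous_of_finiteDimensional
  have hcont : Continuous fun X => ‖A X - b‖ ^ 2 := by fun_prop
  -- The threshold forces ‖AX‖ ≥ 2‖b‖ on C, hence ‖AX - b‖ ≥ ‖b‖, the residual at 0.
  have hlarge : ∀ᶠ X : Matrix (Fin m) (Fin n) 𝕜 in cocompact _,
      (2 * ‖b‖) ^ 2 / (1 - lrip A K) ≤ ‖X‖ ^ 2 :=
    ((tendsto_pow_atTop two_ne_zero).comp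
      (tendsto_norm_cocompact_atTop (E := Matrix (Fin m) (Fin n) 𝕜))).eventually_ge_atTop _
  obtain ⟨X, hX, hmin⟩ := hcont.continuousOn.exists_isMinOn' (isClosed_rank_le K)
    (x₀ := (0 : Matrix (Fin m) (Fin n) 𝕜)) (by simp) (by
      filter_upwards [hlarge.filter_mono inf_le_left, mem_inf_of_right (mem_principal_self _)]
        with X h1 h2
      rw [div_le_iff₀ (by linarith)] at h1
      have h3 := one_sub_lrip_mul_le A h2
      have h4 : 2 * ‖b‖ ≤ ‖A X‖ :=
        le_of_sq_le_sq (by linarith) (norm_nonneg _)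
      have h5 := norm_sub_norm_le (A X) b
      rw [map_zero, zero_sub, norm_neg]
      exact pow_le_pow_left₀ (norm_nonneg _) (by linarith) 2)
  exact ⟨X, hX, fun W hW => hmin hW⟩

end RestrictedIsometry

/-! ### The regularized objective and uniqueness of its stationary points. -/

section Objective

variable {𝕜 : Type*} [RCLike 𝕜] {m n : ℕ} {E : Type*} [NormedAddCommGroup E]
  [InnerProductSpace ℝ E]

theorem norm_apply_lt_of_opNorm_lt_one {A : Matrix (Fin m) (Fin n) 𝕜 →ₗ[ℝ] E} (hA : opNorm A < 1)
    {X : Matrix (Fin m) (Fin n) 𝕜} (hX : X ≠ 0) : ‖A X‖ < ‖X‖ := by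
  have h := (LinearMap.toContinuousLinearMap A).le_opNorm X
  have h0 : 0 < ‖X‖ := norm_pos_iff.2 hX
  exact h.trans_lt (mul_lt_of_lt_one_left h0 hA)

theorem norm_apply_le_of_opNorm_lt_one {A : Matrix (Fin m) (Fin n) 𝕜 →ₗ[ℝ] E} (hA : opNorm A < 1)
    (X : Matrix (Fin m) (Fin n) 𝕜) : ‖A X‖ ≤ ‖X‖ := by
  rcases eq_or_ne X 0 with rfl | h
  · simp
  · exact (norm_apply_lt_of_opNorm_lt_one hA h).le

theorem regObjective_eq_coe [FiniteDimensional ℝ E] (A : Matrix (Fin m) (Fin n) 𝕜 →ₗ[ℝ] E) (b : E)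
    {K : ℕ} (hK : 1 ≤ K) :
    regObjective A b K = fun X =>
      ((envObjective A b {X : Matrix (Fin m) (Fin n) 𝕜 | X.rank ≤ K} X : ℝ) : EReal) := by
  funext X
  rw [regObjective, quadEnvelope_indicator (f := rankIndicator K) (isClosed_rank_le K)
    (rank_le_nonempty K) (fun X hX => if_pos hX) (fun X hX => if_neg hX) (envelopeFinite_rank_le hK X),
    ← EReal.coe_add]
  rfl

theorem eq_of_nearest_of_gap [FiniteDimensional ℝ E] {A : Matrix (Fin m) (Fin n) 𝕜 →ₗ[ℝ] E} {b : E}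
    {K : ℕ} (hK : 1 ≤ K) (hA : ∀ X, ‖A X‖ ≤ ‖X‖) {X Y : Matrix (Fin m) (Fin n) 𝕜}
    (hX : X.rank ≤ K) (hY : Y.rank ≤ K)
    (hXbest : ∀ W : Matrix (Fin m) (Fin n) 𝕜, W.rank ≤ K →
      2 * inner ℝ (gradStep A b X) W - ‖W‖ ^ 2 ≤ 2 * inner ℝ (gradStep A b X) X - ‖X‖ ^ 2)
    (hYbest : ∀ W : Matrix (Fin m) (Fin n) 𝕜, W.rank ≤ K →
      2 * inner ℝ (gradStep A b Y) W - ‖W‖ ^ 2 ≤ 2 * inner ℝ (gradStep A b Y) Y - ‖Y‖ ^ 2)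
    (hgap : sigma (K + 1) (gradStep A b X) <
      (1 - 2 * lrip A (2 * K)) * sigma K (gradStep A b X)) : Y = X := by
  set Z := gradStep A b X with hZ
  have h0 := lrip_nonneg hA (2 * K)
  have hs1 : 0 ≤ sigma (K + 1) Z := LinearMap.singularValues_nonneg _ _
  have hs2 : 0 ≤ sigma K Z := LinearMap.singularValues_nonneg _ _
  have hpos : 0 < sigma K Z := hs2.lt_of_ne' fun h => by rw [h] at hgap; linarith
  have hδ : 0 < 1 - 2 * lrip A (2 * K) := pos_of_mul_pos_left (hs1.trans_lt hgap) hs2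
  have hgap' : sigma (K + 1) Z < sigma K Z :=
    hgap.trans_le (mul_le_of_le_one_left hs2 (by linarith))
  -- The ratio σ_{K+1}/σ_K may be 0, so c is also kept positive, as c⁻¹ is needed. Strictness below
  -- 1 - 2δ_{2K} gives the final contradiction.
  obtain ⟨c, hc1, hc2⟩ := exists_between
    (max_lt (((div_lt_iff₀ hpos).2 hgap)) hδ)
  rw [max_lt_iff, div_lt_iff₀ hpos] at hc1
  by_contra hne
  have hD : 0 < ‖Y - X‖ ^ 2 := by
    have := sub_ne_zero.2 hne
    positivity
  have h1 := two_inner_residual_le hK hX hXbest hc1.2 hgap' hc1.1.le hY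
  have h2 := hYbest X hX
  have h3 := inner_gradStep_sub A b X Y
  have h4 := one_sub_lrip_mul_le A (k := 2 * K) (X := Y - X)
    ((rank_sub_le Y X).trans (by omega))
  have h5 := norm_sub_sq_real Y X
  have h6 := mul_lt_mul_of_pos_right hc2 hD
  have h7 := real_inner_comm X Y
  have h8 := real_inner_self_eq_norm_sq X
  simp only [inner_sub_left, inner_sub_right, ← hZ] at h1 h3
  linarith

end Objective

end LowRank

/-- `A` is a real-linear operator on the real or complex `n₁ × n₂` matrices (Frobenius norm) with
values in a finite-dimensional real inner product space, such as `ℝᵐ`, or `ℂᵐ` with `Re ⟪·,·⟫`;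
a complex-linear `A` is a special case, with the same norm and the same adjoint. -/
theorem theorem6p3 {𝕜 : Type*} [RCLike 𝕜] {n₁ n₂ : ℕ} {E : Type*} [NormedAddCommGroup E]
    [InnerProductSpace ℝ E] [FiniteDimensional ℝ E]
    (A : Matrix (Fin n₁) (Fin n₂) 𝕜 →ₗ[ℝ] E) (b : E) (K : ℕ) (hK : 1 ≤ K)
    (hA : LowRank.opNorm A < 1) :
    (LowRank.lrip A K < 1 →
      ∃ X' : Matrix (Fin n₁) (Fin n₂) 𝕜,
        ∀ X, LowRank.regObjective A b K X' ≤ LowRank.regObjective A b K X) ∧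
    (∀ X' : Matrix (Fin n₁) (Fin n₂) 𝕜,
      (∀ X, LowRank.regObjective A b K X' ≤ LowRank.regObjective A b K X) →
      LowRank.sigma (K + 1) (LowRank.assocPoint A b X') <
        (1 - 2 * LowRank.lrip A (2 * K)) * LowRank.sigma K (LowRank.assocPoint A b X') →
      (∀ Y : Matrix (Fin n₁) (Fin n₂) 𝕜,
        (∀ X, LowRank.regObjective A b K Y ≤ LowRank.regObjective A b K X) → Y = X') ∧
      (∀ Y : Matrix (Fin n₁) (Fin n₂) 𝕜,
        IsLocalMin (LowRank.regObjective A b K) Y → Y = X')) := by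
  have hlt : ∀ X, X ≠ 0 → ‖A X‖ < ‖X‖ := fun X => LowRank.norm_apply_lt_of_opNorm_lt_one hA
  have hle := LowRank.norm_apply_le_of_opNorm_lt_one hA
  have hclosed := LowRank.isClosed_rank_le (𝕜 := 𝕜) (m := n₁) (n := n₂) K
  have hfin := LowRank.envelopeFinite_rank_le (𝕜 := 𝕜) (m := n₁) (n := n₂) hK
  rw [LowRank.regObjective_eq_coe A b hK]
  refine ⟨fun hrip => ?_, fun X' hX' hgap => ?_⟩
  · obtain ⟨X₀, hX₀, hmin⟩ := LowRank.exists_isMinOn_rank_le b hrip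
    exact ⟨X₀, fun X => EReal.coe_le_coe_iff.2
      (LowRank.envObjective_le_of_isMinOn hle hclosed (LowRank.rank_le_nonempty K) hfin hX₀ hmin X)⟩
  · have hnear : ∀ Y : Matrix (Fin n₁) (Fin n₂) 𝕜,
        IsLocalMin (fun X => ((LowRank.envObjective A b
          {X : Matrix (Fin n₁) (Fin n₂) 𝕜 | X.rank ≤ K} X : ℝ) : EReal)) Y →
        Y.rank ≤ K ∧ ∀ W : Matrix (Fin n₁) (Fin n₂) 𝕜, W.rank ≤ K →
          2 * inner ℝ (LowRank.gradStep A b Y) W - ‖W‖ ^ 2 ≤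
            2 * inner ℝ (LowRank.gradStep A b Y) Y - ‖Y‖ ^ 2 := by
      intro Y hY
      obtain ⟨h1, h2⟩ := LowRank.isNearest_of_isLocalMin (b := b) hlt hclosed (LowRank.rank_le_nonempty K) hfin
        (hY.mono fun X hX => EReal.coe_le_coe_iff.1 hX)
      exact ⟨h1, fun W hW => (LowRank.le_projGain (C := {X : Matrix (Fin n₁) (Fin n₂) 𝕜 | X.rank ≤ K})
        hW _).trans_eq h2.symm⟩
    have hloc : ∀ Y : Matrix (Fin n₁) (Fin n₂) 𝕜,
        IsLocalMin (fun X => ((LowRank.envObjective A b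
          {X : Matrix (Fin n₁) (Fin n₂) 𝕜 | X.rank ≤ K} X : ℝ) : EReal)) Y → Y = X' := by
      intro Y hY
      obtain ⟨h1, h2⟩ := hnear X' (Filter.Eventually.of_forall hX')
      obtain ⟨h3, h4⟩ := hnear Y hY
      -- The gap is assumed only at X', and `assocPoint` agrees with `gradStep` by definition.
      exact LowRank.eq_of_nearest_of_gap hK hle h1 h3 h2 h4 hgap
    exact ⟨fun Y hY => hloc Y (Filter.Eventually.of_forall hY), hloc⟩
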